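/- For a finite simple graph $G=(V,E)$ let $\omega(G)$ be the maximum number of vertices of a clique of $G$. A nonedge of $G$ is a pair of distinct nonadjacent vertices, and for $b\subseteq V$ let $\Gamma(b)$ be the set of common neighbors of $b$, i.e. of all vertices $v\notin b$ that are adjacent to every vertex of $b$. In the relaxed clique game on $G$ (where $G$ is known to both players), Alice gets a set $a\subseteq V$ and Bob gets a set $b\subseteq V$ such that $a\cap b=\emptyset$ and $|a|+|b|>\omega(G)$. The goal is to find a nonedge of $G$, known to both players at the end, which either lies within $a\cup b$ (both endpoints in $a\cup b$) or lies between $a$ and $\Gamma(b)$ (one endpoint in $a$, the other in $\Gamma(b)$). Theorem. There is an absolute constant $C$ such that for every $n\ge 1$ and every $n$-vertex graph $G$, some deterministic two-party communication protocol solves the relaxed clique game on $G$ and communicates at most $7.3\log_2 n+C$ bits on every input $(a,b)$ of the game. -/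

import Mathlib

/-- A deterministic two-party communication protocol. Alice's inputs are of type `X`, Bob's inputs
are of type `Y`, and the answers are of type `Z`. At an inner node the owner of the node sends one
bit, which depends only on the owner's input and on the node (that is, on the bits sent so far);
the bit `false` leads to the first subtree and `true` to the second. The answer is written at the
leaf, so it is determined by the transcript and known to both players. -/
inductive CommProtocol (X : Type*) (Y : Type*) (Z : Type*)
  | leaf (z : Z) : CommProtocol X Y Z
  | alice (f : X → Bool) (P Q : CommProtocol X Y Z) : CommProtocol X Y Z
  | bob (g : Y → Bool) (P Q : CommProtocol X Y Z) : CommProtocol X Y Z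

/-- The answer of the protocol on the input `(x, y)`. -/
def CommProtocol.output {X Y Z : Type*} : CommProtocol X Y Z → X → Y → Z
  | .leaf z, _, _ => z
  | .alice f P Q, x, y => if f x then Q.output x y else P.output x y
  | .bob g P Q, x, y => if g y then Q.output x y else P.output x y

/-- The number of bits communicated on the input `(x, y)`. -/
def CommProtocol.bits {X Y Z : Type*} : CommProtocol X Y Z → X → Y → ℕ
  | .leaf _, _, _ => 0
  | .alice f P Q, x, y => (if f x then Q.bits x y else P.bits x y) + 1
  | .bob g P Q, x, y => (if g y then Q.bits x y else P.bits x y) + 1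

namespace RelaxedCliqueGame

variable {V : Type*} (G : SimpleGraph V)

/-- The set of common neighbors of `b`: the vertices outside `b` adjacent to all vertices
of `b`. -/
def commonNeighbors (b : Finset V) : Set V :=
  {v | v ∉ b ∧ ∀ u ∈ b, G.Adj v u}

/-- The promise: `a` and `b` are disjoint and `|a| + |b|` exceeds the clique number of `G`. -/
def Promise (a b : Finset V) : Prop :=
  Disjoint a b ∧ G.cliqueNum < a.card + b.card

/-- `e` is a legal answer on the input `(a, b)`: it is a nonedge of `G` (a pair of distinct
nonadjacent vertices) which lies within `a ∪ b`, or between `a` and the common neighbors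
of `b`. -/
def IsLegalAnswer (a b : Finset V) (e : Sym2 V) : Prop :=
  e ∈ Gᶜ.edgeSet ∧
    ((∀ v ∈ e, v ∈ a ∨ v ∈ b) ∨ ∃ u ∈ a, ∃ v ∈ commonNeighbors G b, e = s(u, v))

/-- The protocol gives a legal answer on every input that satisfies the promise. -/
def Solves (P : CommProtocol (Finset V) (Finset V) (Sym2 V)) : Prop :=
  ∀ a b : Finset V, Promise G a b → IsLegalAnswer G a b (P.output a b)

/-- On every input that satisfies the promise, at most `r` bits are communicated. -/
def CostAtMost (P : CommProtocol (Finset V) (Finset V) (Sym2 V)) (r : ℝ) : Prop :=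
  ∀ a b : Finset V, Promise G a b → (P.bits a b : ℝ) ≤ r

end RelaxedCliqueGame

/-!
Bob handles the case where `b` is not a clique alone: he sends a nonedge inside `b`. If `b` is a
clique, he extends it to a maximal clique `m` and puts `c = m \ b`. Then `c ⊆ Γ(b)` and
`|b| + |c| ≤ ω(G) < |a| + |b|`, so `|c| < |a|`. Once a vertex `v ∈ a \ c` is known, it lies outside
`m` because `a` and `b` are disjoint, so by maximality Bob can name a vertex `u ∈ m` that is not
adjacent to `v`; the nonedge `uv` lies within `a ∪ b` if `u ∈ b`, and between `a` and `Γ(b)` if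
`u ∈ c`.

It remains to find an element of `a \ c` when `|c| < |a|`, which is the monotone Karchmer–Wigderson
game of a majority function, and is solved with Valiant's random formulas
(`exists_protocol_mem_sdiff`). Instead of formulas we work with rectangles `A × B` on which a short
protocol is correct: such rectangles are closed under `(A ∩ A') × (B ∪ B')` and
`(A ∪ A') × (B ∩ B')` at the price of one bit each. For `2n + 1` elementary rectangles, every
input of Alice lies in exactly `n + 1` of the sides `A`, and every input of Bob in exactly `n + 1`
of the sides `B`: for each vertex `v` take `{a | v ∈ a} × {c | v ∉ c}`, and for each `j ≤ n` take
`{a | |a| ≤ j} × {c | j ≤ |c|}`, which no pair with `|c| < |a|` enters. A random elementary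
rectangle, replaced with a suitable probability by `∅ × univ`, contains every `a` with probability
`α + α / (2n + 1)` and misses every `c` with probability `α - α / (2n + 1)`, where
`α = (3 - √5) / 2` is the unstable fixed point of `p ↦ (1 - (1 - p)²)²`. This map describes two
rounds of combining independent copies. It expands distances to `α` by a factor `7/5` near `α`, and
makes the error probabilities decrease doubly exponentially farther away, so that
`(15/7 + 1) log₂ n + O(1)` double rounds bring the errors below `2 ^ (-n - 2)`; the union bound then
gives a rectangle which contains all inputs. The cost is `2 (15/7 + 1) log₂ n + O(1)` bits for
finding `v` and `log₂ n + O(1)` bits for naming `u`, and `2 (15/7 + 1) + 1 = 51/7 < 7.3`.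
-/

/-! ### Composing protocols -/

namespace CommProtocol

/-- Run the first protocol, and continue with the protocol that its answer selects. -/
def bind {X Y Z W : Type*} (T : Z → CommProtocol X Y W) : CommProtocol X Y Z → CommProtocol X Y W
  | .leaf z => T z
  | .alice f P Q => .alice f (P.bind T) (Q.bind T)
  | .bob g P Q => .bob g (P.bind T) (Q.bind T)

variable {X Y Z W : Type*}

theorem output_bind (T : Z → CommProtocol X Y W) (P : CommProtocol X Y Z) (x : X) (y : Y) :
    (P.bind T).output x y = (T (P.output x y)).output x y := by
  induction P with
  | leaf z => rfl
  | alice f P Q hP hQ => simp only [bind, output]; split <;> assumption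
  | bob g P Q hP hQ => simp only [bind, output]; split <;> assumption

theorem bits_bind (T : Z → CommProtocol X Y W) (P : CommProtocol X Y Z) (x : X) (y : Y) :
    (P.bind T).bits x y = P.bits x y + (T (P.output x y)).bits x y := by
  induction P with
  | leaf z => simp [bind, output, bits]
  | alice f P Q hP hQ => simp only [bind, output, bits]; split <;> omega
  | bob g P Q hP hQ => simp only [bind, output, bits]; split <;> omega

/-- Bob can send a word of `k` bits; what follows may depend on that word. -/
theorem exists_bob_sends_word (k : ℕ) (g : Y → Fin k → Bool) (F : (Fin k → Bool) → Z) :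
    ∃ P : CommProtocol X Y Z, ∀ x y, P.output x y = F (g y) ∧ P.bits x y = k := by
  induction k with
  | zero =>
    refine ⟨.leaf (F Fin.elim0), fun x y => ⟨?_, rfl⟩⟩
    simp only [output]
    congr 1
    exact Subsingleton.elim _ _
  | succ k ih =>
    choose P hP using fun s : Bool => ih (fun y => Fin.tail (g y)) (fun w => F (Fin.cons s w))
    refine ⟨.bob (fun y => g y 0) (P false) (P true), fun x y => ?_⟩
    have h := hP (g y 0) x y
    rw [show (Fin.cons (g y 0) (Fin.tail (g y)) : Fin (k + 1) → Bool) = g y from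
      Fin.cons_self_tail _] at h
    cases h0 : g y 0 <;> simp [output, bits, h0] at h ⊢ <;> exact h

/-- Bob can send an element of a set with at most `2 ^ k` elements by sending `k` bits. -/
theorem exists_bob_sends {W : Type*} [Fintype W] [Nonempty W] {k : ℕ}
    (hk : Fintype.card W ≤ 2 ^ k) (g : Y → W) (F : W → Z) :
    ∃ P : CommProtocol X Y Z, ∀ x y, P.output x y = F (g y) ∧ P.bits x y = k := by
  obtain ⟨e⟩ : Nonempty (W ↪ (Fin k → Bool)) :=
    Function.Embedding.nonempty_of_card_le (by simpa using hk)
  obtain ⟨P, hP⟩ := exists_bob_sends_word (X := X) k (fun y => e (g y))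
    (fun w => F (Function.invFun e w))
  refine ⟨P, fun x y => ?_⟩
  rw [(hP x y).1, Function.leftInverse_invFun e.injective]
  exact ⟨rfl, (hP x y).2⟩

end CommProtocol

/-! ### Rectangles on which a short protocol is correct -/

/-- Some protocol of cost at most `d` gives answers correct for the relation `R` on all inputs from
the rectangle `A × B`. -/
def SolvableOn {X Y Z : Type*} (R : X → Y → Z → Prop) (d : ℕ) (A : Set X) (B : Set Y) : Prop :=
  ∃ P : CommProtocol X Y Z, (∀ x y, P.bits x y ≤ d) ∧ ∀ x ∈ A, ∀ y ∈ B, R x y (P.output x y)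

namespace SolvableOn

variable {X Y Z : Type*} {R : X → Y → Z → Prop} {d : ℕ} {A A' : Set X} {B B' : Set Y}

theorem of_leaf (z : Z) (h : ∀ x ∈ A, ∀ y ∈ B, R x y z) : SolvableOn R 0 A B :=
  ⟨.leaf z, fun _ _ => le_rfl, h⟩

/-- Bob announces which of the two sides his input belongs to. -/
theorem inter_union (h : SolvableOn R d A B) (h' : SolvableOn R d A' B') :
    SolvableOn R (d + 1) (A ∩ A') (B ∪ B') := by
  classical
  obtain ⟨P, hP, hR⟩ := h
  obtain ⟨P', hP', hR'⟩ := h'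
  refine ⟨.bob (fun y => decide (y ∉ B)) P P', fun x y => ?_, fun x hx y hy => ?_⟩
  · have := hP x y
    have := hP' x y
    simp only [CommProtocol.bits]
    split <;> omega
  · by_cases hB : y ∈ B
    · simpa [CommProtocol.output, hB] using hR x hx.1 y hB
    · simpa [CommProtocol.output, hB] using hR' x hx.2 y (hy.resolve_left hB)

/-- Alice announces which of the two sides her input belongs to. -/
theorem union_inter (h : SolvableOn R d A B) (h' : SolvableOn R d A' B') :
    SolvableOn R (d + 1) (A ∪ A') (B ∩ B') := by
  classical
  obtain ⟨P, hP, hR⟩ := h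
  obtain ⟨P', hP', hR'⟩ := h'
  refine ⟨.alice (fun x => decide (x ∉ A)) P P', fun x y => ?_, fun x hx y hy => ?_⟩
  · have := hP x y
    have := hP' x y
    simp only [CommProtocol.bits]
    split <;> omega
  · by_cases hA : x ∈ A
    · simpa [CommProtocol.output, hA] using hR x hA y hy.1
    · simpa [CommProtocol.output, hA] using hR' x (hx.resolve_left hA) y hy.2

end SolvableOn

/-! ### Random rectangles -/

universe u

/-- There is a random rectangle `A × B`, every value of which is solvable with cost `d`, such that
`x ∈ A` has probability `p x` for all `x`, and `y ∉ B` has probability `t y` for all `y`. The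
probability space is a finite type `Ω` with real weights `w`. -/
def RandomlySolvable {X Y Z : Type u} (R : X → Y → Z → Prop) (d : ℕ) (p : X → ℝ) (t : Y → ℝ) :
    Prop :=
  ∃ (Ω : Type u) (_ : Fintype Ω) (w : Ω → ℝ) (A : Ω → Set X) (B : Ω → Set Y),
    (∀ i, 0 ≤ w i) ∧ ∑ i, w i = 1 ∧ (∀ i, SolvableOn R d (A i) (B i)) ∧
    (∀ x, ∑ i, w i * (A i).indicator 1 x = p x) ∧ ∀ y, ∑ i, w i * (B i)ᶜ.indicator 1 y = t y

/-- Two independent random sets both contain `x` with the product of the probabilities. -/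
theorem sum_mul_indicator_inter {Ω X : Type*} [Fintype Ω] (w : Ω → ℝ) (A : Ω → Set X) (x : X) :
    ∑ i : Ω × Ω, w i.1 * w i.2 * (A i.1 ∩ A i.2).indicator 1 x =
      (∑ i, w i * (A i).indicator 1 x) ^ 2 := by
  rw [sq, Finset.sum_mul_sum, Fintype.sum_prod_type]
  refine Finset.sum_congr rfl fun i _ => Finset.sum_congr rfl fun j _ => ?_
  rw [Set.inter_indicator_one, Pi.mul_apply]
  ring

theorem sum_mul_indicator_union {Ω X : Type*} [Fintype Ω] (w : Ω → ℝ) (hw : ∑ i, w i = 1)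
    (A : Ω → Set X) (x : X) :
    ∑ i : Ω × Ω, w i.1 * w i.2 * (A i.1 ∪ A i.2).indicator 1 x =
      1 - (1 - ∑ i, w i * (A i).indicator 1 x) ^ 2 := by
  have key (i : Ω × Ω) : w i.1 * w i.2 * (A i.1 ∪ A i.2).indicator 1 x =
      w i.1 * w i.2 - w i.1 * w i.2 * ((A i.1)ᶜ ∩ (A i.2)ᶜ).indicator 1 x := by
    by_cases h : x ∈ A i.1 <;> by_cases h' : x ∈ A i.2 <;> simp [h, h']
  have compl : ∑ i, w i * (A i)ᶜ.indicator 1 x = 1 - ∑ i, w i * (A i).indicator 1 x := by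
    rw [← hw, ← Finset.sum_sub_distrib]
    refine Finset.sum_congr rfl fun i _ => ?_
    by_cases h : x ∈ A i <;> simp [h]
  rw [Finset.sum_congr rfl fun i _ => key i, Finset.sum_sub_distrib,
    sum_mul_indicator_inter w (fun i => (A i)ᶜ) x, compl, Fintype.sum_prod_type]
  simp only [← Finset.mul_sum, hw, mul_one]

/-- The effect of two rounds of combining independent copies of a random rectangle on the
probabilities: first a union, then an intersection. -/
def amplify (p : ℝ) : ℝ := (1 - (1 - p) ^ 2) ^ 2

namespace RandomlySolvable

variable {X Y Z : Type u} {R : X → Y → Z → Prop} {d : ℕ} {p : X → ℝ} {t : Y → ℝ}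

theorem inter_union (h : RandomlySolvable R d p t) :
    RandomlySolvable R (d + 1) (fun x => p x ^ 2) (fun y => t y ^ 2) := by
  obtain ⟨Ω, _, w, A, B, hw, hw1, hS, hp, ht⟩ := h
  refine ⟨Ω × Ω, inferInstance, fun i => w i.1 * w i.2, fun i => A i.1 ∩ A i.2,
    fun i => B i.1 ∪ B i.2, fun i => mul_nonneg (hw _) (hw _), ?_,
    fun i => (hS i.1).inter_union (hS i.2), fun x => ?_, fun y => ?_⟩
  · rw [Fintype.sum_prod_type]
    simp only [← Finset.mul_sum, hw1, mul_one]
  · rw [sum_mul_indicator_inter, hp]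
  · simp only [Set.compl_union]
    rw [sum_mul_indicator_inter w (fun i => (B i)ᶜ), ht]

theorem union_inter (h : RandomlySolvable R d p t) :
    RandomlySolvable R (d + 1) (fun x => 1 - (1 - p x) ^ 2) (fun y => 1 - (1 - t y) ^ 2) := by
  obtain ⟨Ω, _, w, A, B, hw, hw1, hS, hp, ht⟩ := h
  refine ⟨Ω × Ω, inferInstance, fun i => w i.1 * w i.2, fun i => A i.1 ∪ A i.2,
    fun i => B i.1 ∩ B i.2, fun i => mul_nonneg (hw _) (hw _), ?_,
    fun i => (hS i.1).union_inter (hS i.2), fun x => ?_, fun y => ?_⟩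
  · rw [Fintype.sum_prod_type]
    simp only [← Finset.mul_sum, hw1, mul_one]
  · rw [sum_mul_indicator_union w hw1, hp]
  · simp only [Set.compl_inter]
    rw [sum_mul_indicator_union w hw1 (fun i => (B i)ᶜ), ht]

theorem amplify_iterate (h : RandomlySolvable R d p t) (k : ℕ) :
    RandomlySolvable R (d + 2 * k) (fun x => amplify^[k] (p x)) (fun y => amplify^[k] (t y)) := by
  induction k with
  | zero => exact h
  | succ k ih =>
    simp only [Function.iterate_succ_apply']
    exact ih.union_inter.inter_union

/-- The union bound: if all errors are small, then some rectangle contains all inputs. -/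
theorem exists_solvableOn_univ [Fintype X] [Fintype Y] (h : RandomlySolvable R d p t)
    (hpt : ∑ x, (1 - p x) + ∑ y, t y < 1) : SolvableOn R d Set.univ Set.univ := by
  classical
  obtain ⟨Ω, _, w, A, B, hw, hw1, hS, hp, ht⟩ := h
  by_cases hgood : ∃ i, A i = Set.univ ∧ B i = Set.univ
  · obtain ⟨i, hA, hB⟩ := hgood
    simpa [hA, hB] using hS i
  refine absurd hpt (not_lt.2 ?_)
  have hp' (x : X) : 1 - p x = ∑ i, w i * (A i)ᶜ.indicator 1 x := by
    rw [← hw1, ← hp, ← Finset.sum_sub_distrib]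
    refine Finset.sum_congr rfl fun i _ => ?_
    by_cases h : x ∈ A i <;> simp [h]
  simp only [hp', ← ht]
  rw [Finset.sum_comm, Finset.sum_comm (s := (Finset.univ : Finset Y)), ← Finset.sum_add_distrib,
    ← hw1]
  refine Finset.sum_le_sum fun i _ => ?_
  rw [← Finset.mul_sum, ← Finset.mul_sum, ← mul_add]
  refine le_mul_of_one_le_right (hw i) ?_
  have nonneg {T : Type u} (S : Set T) (s : T) : (0 : ℝ) ≤ S.indicator 1 s :=
    Set.indicator_nonneg (fun _ _ => zero_le_one) s
  rcases not_and_or.1 (not_exists.1 hgood i) with hA | hB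
  · obtain ⟨x, hx⟩ := (Set.ne_univ_iff_exists_notMem _).1 hA
    have := Finset.single_le_sum (f := fun x => (A i)ᶜ.indicator (1 : X → ℝ) x)
      (fun x _ => nonneg _ x) (Finset.mem_univ x)
    have := Finset.sum_nonneg (s := Finset.univ) fun y _ => nonneg (B i)ᶜ y
    simp only [Set.indicator_of_mem (Set.mem_compl hx), Pi.one_apply] at *
    linarith
  · obtain ⟨y, hy⟩ := (Set.ne_univ_iff_exists_notMem _).1 hB
    have := Finset.single_le_sum (f := fun y => (B i)ᶜ.indicator (1 : Y → ℝ) y)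
      (fun y _ => nonneg _ y) (Finset.mem_univ y)
    have := Finset.sum_nonneg (s := Finset.univ) fun x _ => nonneg (A i)ᶜ x
    simp only [Set.indicator_of_mem (Set.mem_compl hy), Pi.one_apply] at *
    linarith

end RandomlySolvable

/-! ### Iterating the amplification map -/

theorem amplify_nonneg (p : ℝ) : 0 ≤ amplify p := sq_nonneg _

theorem amplify_le_amplify {p p' : ℝ} (h0 : 0 ≤ p) (h : p ≤ p') (h1 : p' ≤ 1) :
    amplify p ≤ amplify p' := by
  unfold amplify
  have : (1 - p') ^ 2 ≤ (1 - p) ^ 2 := by gcongr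
  have : (1 - p) ^ 2 ≤ 1 := by nlinarith
  gcongr

theorem amplify_le_one {p : ℝ} (h0 : 0 ≤ p) (h1 : p ≤ 1) : amplify p ≤ 1 := by
  simpa [amplify] using amplify_le_amplify h0 h1 le_rfl

theorem amplify_iterate_mem (k : ℕ) {p : ℝ} (hp : p ∈ Set.Icc 0 1) :
    amplify^[k] p ∈ Set.Icc 0 1 := by
  induction k with
  | zero => exact hp
  | succ k ih =>
    rw [Function.iterate_succ_apply']
    exact ⟨amplify_nonneg _, amplify_le_one ih.1 ih.2⟩

/-- `1 - q` is the fixed point of `amplify`, since `q² = 1 - q` forces `q = (√5 - 1) / 2`. The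
derivative there is `4q² ≈ 1.528`, which leaves room for the factor `1.4` up to distance `0.15`;
that distance is enough to pass `1/2`. -/
theorem le_amplify_iterate {q e : ℝ} (hq : q ^ 2 = 1 - q) (hq0 : 0.618 < q) (hq1 : q < 0.619)
    (he : 0 ≤ e) (he1 : 1 - q + e ≤ 1) (k : ℕ) :
    1 - q + min (1.4 ^ k * e) 0.15 ≤ amplify^[k] (1 - q + e) := by
  induction k with
  | zero => simp
  | succ k ih =>
    rw [Function.iterate_succ_apply']
    set m := min (1.4 ^ k * e) 0.15 with hm
    have hm0 : 0 ≤ m := le_min (by positivity) (by norm_num)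
    have hm1 : m ≤ 0.15 := min_le_right _ _
    have hstep : 1 - q + 1.4 * m ≤ amplify (1 - q + m) := by
      have : amplify (1 - q + m) - (1 - q + 1.4 * m) =
          m * ((4 * q ^ 2 - 1.4) + (4 * q ^ 2 - 2 * q) * m - 4 * q * m ^ 2 + m ^ 3) := by
        have h1 : 1 - (1 - (1 - q + m)) ^ 2 = q + 2 * q * m - m ^ 2 := by linear_combination -hq
        rw [amplify, h1]
        linear_combination hq
      have h2 : 0 ≤ (4 * q ^ 2 - 1.4) + (4 * q ^ 2 - 2 * q) * m - 4 * q * m ^ 2 + m ^ 3 := by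
        have : 0 ≤ m ^ 3 := by positivity
        have : q * m ^ 2 ≤ 0.619 * 0.15 ^ 2 := by gcongr
        have : 0 ≤ (4 * q ^ 2 - 2 * q) * m := mul_nonneg (by rw [hq]; linarith) hm0
        rw [hq] at *
        linarith
      linarith [mul_nonneg hm0 h2]
    have hmono : amplify (1 - q + m) ≤ amplify (amplify^[k] (1 - q + e)) :=
      amplify_le_amplify (by linarith) ih
        (amplify_iterate_mem k ⟨by linarith, he1⟩).2
    have : min (1.4 ^ (k + 1) * e) 0.15 ≤ 1.4 * m := by
      rw [hm, mul_min_of_nonneg _ _ (by norm_num : (0 : ℝ) ≤ 1.4)]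
      exact min_le_min (by rw [pow_succ]; linarith) (by norm_num)
    linarith

/-- The counterpart of `le_amplify_iterate` below the fixed point; distance `0.15` is enough to get
below `1/4`. -/
theorem amplify_iterate_le {q e : ℝ} (hq : q ^ 2 = 1 - q) (hq0 : 0.618 < q) (hq1 : q < 0.619)
    (he : 0 ≤ e) (he1 : e ≤ 1 - q) (k : ℕ) :
    amplify^[k] (1 - q - e) ≤ 1 - q - min (1.4 ^ k * e) 0.15 := by
  induction k with
  | zero =>
    have := min_le_left e 0.15
    simpa using by linarith
  | succ k ih =>
    rw [Function.iterate_succ_apply']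
    set m := min (1.4 ^ k * e) 0.15 with hm
    have hm0 : 0 ≤ m := le_min (by positivity) (by norm_num)
    have hm1 : m ≤ 0.15 := min_le_right _ _
    have hstep : amplify (1 - q - m) ≤ 1 - q - 1.4 * m := by
      have : 1 - q - 1.4 * m - amplify (1 - q - m) =
          m * ((4 * q ^ 2 - 1.4) - (4 * q ^ 2 - 2 * q) * m - 4 * q * m ^ 2 - m ^ 3) := by
        have h1 : 1 - (1 - (1 - q - m)) ^ 2 = q - 2 * q * m - m ^ 2 := by linear_combination -hq
        rw [amplify, h1]
        linear_combination -hq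
      have h2 : 0 ≤ (4 * q ^ 2 - 1.4) - (4 * q ^ 2 - 2 * q) * m - 4 * q * m ^ 2 - m ^ 3 := by
        have : m ^ 3 ≤ 0.15 ^ 3 := by gcongr
        have : q * m ^ 2 ≤ 0.619 * 0.15 ^ 2 := by gcongr
        have : (4 * q ^ 2 - 2 * q) * m ≤ 0.3 * 0.15 := by
          gcongr
          rw [hq]
          linarith
        rw [hq] at *
        linarith
      linarith [mul_nonneg hm0 h2]
    have hmono : amplify (amplify^[k] (1 - q - e)) ≤ amplify (1 - q - m) :=
      amplify_le_amplify (amplify_iterate_mem k ⟨by linarith, by linarith⟩).1 ih (by linarith)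
    have : min (1.4 ^ (k + 1) * e) 0.15 ≤ 1.4 * m := by
      rw [hm, mul_min_of_nonneg _ _ (by norm_num : (0 : ℝ) ≤ 1.4)]
      exact min_le_min (by rw [pow_succ]; linarith) (by norm_num)
    linarith

/-- Once the probability exceeds `1/2`, the error `ε` decreases at least as fast as under
`2ε ↦ (2ε)²`. -/
theorem one_sub_amplify_iterate_le {p : ℝ} (hp : 0.53 ≤ p) (hp1 : p ≤ 1) (k : ℕ) :
    1 - amplify^[k] p ≤ 0.94 ^ 2 ^ k := by
  suffices h : 2 * (1 - amplify^[k] p) ≤ 0.94 ^ 2 ^ k by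
    have := (amplify_iterate_mem k ⟨by linarith, hp1⟩).2
    linarith
  induction k with
  | zero => norm_num; linarith
  | succ k ih =>
    have h1 := (amplify_iterate_mem k ⟨by linarith, hp1⟩).2
    rw [Function.iterate_succ_apply', pow_succ 2 k, pow_mul]
    refine le_trans ?_ (pow_le_pow_left₀ (by linarith) ih 2)
    unfold amplify
    nlinarith [sq_nonneg ((1 - amplify^[k] p) ^ 2)]

/-- Once the probability `p` is below `1/4`, it decreases at least as fast as under
`4p ↦ (4p)²`. -/
theorem amplify_iterate_le_pow {p : ℝ} (hp : 0 ≤ p) (hp1 : p ≤ 0.235) (k : ℕ) :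
    amplify^[k] p ≤ 0.94 ^ 2 ^ k := by
  suffices h : 4 * amplify^[k] p ≤ 0.94 ^ 2 ^ k by
    have := (amplify_iterate_mem k ⟨hp, by linarith⟩).1
    linarith
  induction k with
  | zero => norm_num; linarith
  | succ k ih =>
    obtain ⟨h0, h1⟩ := amplify_iterate_mem k ⟨hp, (by linarith : p ≤ 1)⟩
    rw [Function.iterate_succ_apply', pow_succ 2 k, pow_mul]
    refine le_trans ?_ (pow_le_pow_left₀ (by linarith) ih 2)
    have : 1 - (1 - amplify^[k] p) ^ 2 ≤ 2 * amplify^[k] p := by nlinarith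
    have := pow_le_pow_left₀ (by nlinarith) this 2
    rw [amplify]
    linarith

/-! ### Finding an element of the difference of two sets -/

/-- The number of double rounds that brings the deviation from the fixed point from order `1 / n`
to a constant. -/
noncomputable def expansionRounds (n : ℕ) : ℕ := ⌈15 / 7 * Real.logb 2 (2 * n + 1)⌉₊

/-- The number of double rounds that brings the error probability from a constant less than one
below `2 ^ (-n - 2)`. -/
def errorReductionRounds (n : ℕ) : ℕ := Nat.clog 2 (n + 2) + 4

theorem le_pow_expansionRounds (n : ℕ) : (2 * n + 1 : ℝ) ≤ 1.4 ^ expansionRounds n := by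
  set k := expansionRounds n with hk
  have h1 : 15 / 7 * Real.logb 2 (2 * n + 1) ≤ k := Nat.le_ceil _
  -- The constant `15/7` comes from `2 ^ 7 ≤ 1.4 ^ 15`.
  have h2 : (7 / 15 : ℝ) ≤ Real.logb 2 1.4 := by
    have : Real.logb 2 (2 ^ 7) ≤ Real.logb 2 (1.4 ^ 15) :=
      Real.logb_le_logb_of_le (by norm_num) (by norm_num) (by norm_num)
    rw [Real.logb_pow, Real.logb_pow, Real.logb_self_eq_one (by norm_num)] at this
    norm_num at this ⊢
    linarith
  have h3 : Real.logb 2 (2 * n + 1) ≤ Real.logb 2 (1.4 ^ k) := by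
    rw [Real.logb_pow]
    have : (k : ℝ) * (7 / 15) ≤ k * Real.logb 2 1.4 := by gcongr
    linarith
  exact (Real.logb_le_logb (by norm_num) (by positivity) (by positivity)).1 h3

theorem pow_errorReductionRounds_le (n : ℕ) :
    (0.94 : ℝ) ^ 2 ^ errorReductionRounds n ≤ (1 / 2) ^ (n + 2) := by
  have h1 : n + 2 ≤ 2 ^ Nat.clog 2 (n + 2) := Nat.le_pow_clog (by norm_num) _
  calc (0.94 : ℝ) ^ 2 ^ errorReductionRounds n ≤ 0.94 ^ (16 * (n + 2)) := by
        refine pow_le_pow_of_le_one (by norm_num) (by norm_num) ?_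
        rw [errorReductionRounds, pow_add]
        omega
    _ = (0.94 ^ 16) ^ (n + 2) := pow_mul _ _ _
    _ ≤ (1 / 2) ^ (n + 2) := by gcongr; norm_num

/-- The initial random rectangle. With probability `2q - 1` it is `∅ × univ`, and with probability
`2 (1 - q)` it is one of the `2n + 1` elementary rectangles, uniformly. -/
theorem randomlySolvable_mem_sdiff {V X Y : Type u} [Fintype V] [Nonempty V] (a : X → Finset V)
    (c : Y → Finset V) {q : ℝ} (hq0 : 1 / 2 ≤ q) (hq1 : q ≤ 1) :
    RandomlySolvable (fun x y v => (c y).card < (a x).card → v ∈ a x ∧ v ∉ c y) 0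
      (fun _ => 1 - q + (1 - q) / (2 * Fintype.card V + 1))
      (fun _ => 1 - q - (1 - q) / (2 * Fintype.card V + 1)) := by
  classical
  set n := Fintype.card V with hn
  have hn0 : (0 : ℝ) < 2 * n + 1 := by positivity
  refine ⟨Option (V ⊕ Fin (n + 1)), inferInstance,
    fun o => o.elim (2 * q - 1) fun _ => 2 * (1 - q) / (2 * n + 1),
    fun o => o.elim ∅ (Sum.elim (fun v => {x | v ∈ a x}) fun j => {x | (a x).card ≤ j}),
    fun o => o.elim Set.univ (Sum.elim (fun v => {y | v ∉ c y}) fun j => {y | j ≤ (c y).card}),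
    ?_, ?_, ?_, ?_, ?_⟩
  · rintro (_ | _)
    · simp only [Option.elim]
      linarith
    · exact div_nonneg (by linarith) hn0.le
  · simp only [Fintype.sum_option, Option.elim, Finset.sum_const, Finset.card_univ,
      Fintype.card_sum, Fintype.card_fin, ← hn, nsmul_eq_mul]
    push_cast
    field_simp
    ring
  · rintro (_ | v | j)
    · exact .of_leaf (Classical.arbitrary V) fun x hx => hx.elim
    · exact .of_leaf v fun x hx y hy _ => ⟨hx, hy⟩
    · refine .of_leaf (Classical.arbitrary V) fun x hx y hy hlt => ?_
      have : (a x).card ≤ j := hx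
      have : (j : ℕ) ≤ (c y).card := hy
      omega
  · intro x
    have hcard : (a x).card ≤ n := Finset.card_le_univ _
    have h1 : ∑ v, ({x | v ∈ a x} : Set X).indicator (1 : X → ℝ) x = (a x).card := by
      simp [Set.indicator_apply]
    have h2 : ∑ j : Fin (n + 1), ({x | (a x).card ≤ j} : Set X).indicator (1 : X → ℝ) x =
        n + 1 - (a x).card := by
      rw [Fin.sum_univ_eq_sum_range
        (fun j => ({x | (a x).card ≤ j} : Set X).indicator (1 : X → ℝ) x)]
      have : (Finset.range (n + 1)).filter (fun j => (a x).card ≤ j) =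
          Finset.Ico (a x).card (n + 1) := by ext; simp; omega
      simp only [Set.indicator_apply, Set.mem_ofPred_eq, Pi.one_apply, Finset.sum_boole, this,
        Nat.card_Ico]
      rw [Nat.cast_sub (by omega)]
      push_cast
      ring
    simp only [Fintype.sum_option, Fintype.sum_sum_type, Option.elim, Sum.elim_inl, Sum.elim_inr,
      ← Finset.mul_sum, h1, h2, Set.indicator_empty]
    field_simp
    ring
  · intro y
    have hcard : (c y).card ≤ n := Finset.card_le_univ _
    have h1 : ∑ v, ({y | v ∉ c y} : Set Y)ᶜ.indicator (1 : Y → ℝ) y = (c y).card := by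
      simp [Set.indicator_apply]
    have h2 : ∑ j : Fin (n + 1), ({y | j ≤ (c y).card} : Set Y)ᶜ.indicator (1 : Y → ℝ) y =
        n - (c y).card := by
      rw [Fin.sum_univ_eq_sum_range
        (fun j => ({y | j ≤ (c y).card} : Set Y)ᶜ.indicator (1 : Y → ℝ) y)]
      have : (Finset.range (n + 1)).filter (fun j => ¬ j ≤ (c y).card) =
          Finset.Ico ((c y).card + 1) (n + 1) := by ext; simp; omega
      simp only [Set.indicator_apply, Set.mem_compl_iff, Set.mem_ofPred_eq, Pi.one_apply,
        Finset.sum_boole, this, Nat.card_Ico]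
      rw [Nat.cast_sub (by omega)]
      push_cast
      ring
    simp only [Fintype.sum_option, Fintype.sum_sum_type, Option.elim, Sum.elim_inl, Sum.elim_inr,
      ← Finset.mul_sum, h1, h2, Set.compl_univ, Set.indicator_empty]
    field_simp
    ring

/-- If Alice holds a set `a x` and Bob holds a smaller set `c y`, then they can find an element of
`a x \ c y`. -/
theorem exists_protocol_mem_sdiff {V : Type u} [Fintype V] [Nonempty V] (c : Finset V → Finset V) :
    ∃ P : CommProtocol (Finset V) (Finset V) V,
      (∀ x y, P.bits x y ≤
        2 * (errorReductionRounds (Fintype.card V) + expansionRounds (Fintype.card V))) ∧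
      ∀ x y, (c y).card < x.card → P.output x y ∈ x ∧ P.output x y ∉ c y := by
  set n := Fintype.card V with hn
  obtain ⟨q, hq, hq0, hq1⟩ : ∃ q : ℝ, q ^ 2 = 1 - q ∧ 0.618 < q ∧ q < 0.619 := by
    have h5 : √5 ^ 2 = 5 := Real.sq_sqrt (by norm_num)
    have h0 : 2.236 < √5 := Real.lt_sqrt_of_sq_lt (by norm_num)
    have h1 : √5 < 2.238 := (Real.sqrt_lt' (by norm_num)).2 (by norm_num)
    exact ⟨(√5 - 1) / 2, by linear_combination h5 / 4, by linarith, by linarith⟩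
  set e : ℝ := (1 - q) / (2 * n + 1) with he
  have hn0 : (0 : ℝ) < 2 * n + 1 := by positivity
  have he0 : 0 ≤ e := div_nonneg (by linarith) hn0.le
  have he1 : e ≤ 1 - q := div_le_self (by linarith) (by linarith [n.cast_nonneg (α := ℝ)])
  have hmin : min (1.4 ^ expansionRounds n * e) 0.15 = 0.15 := by
    refine min_eq_right ?_
    calc (0.15 : ℝ) ≤ 1 - q := by linarith
      _ = (2 * n + 1) * e := by rw [he]; field_simp
      _ ≤ _ := by gcongr; exact le_pow_expansionRounds n
  have key := ((randomlySolvable_mem_sdiff (fun x : Finset V => x) c (q := q) (by linarith)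
    (by linarith)).amplify_iterate (errorReductionRounds n + expansionRounds n))
  have hA : 1 - amplify^[errorReductionRounds n + expansionRounds n] (1 - q + e) ≤
      (1 / 2) ^ (n + 2) := by
    rw [Function.iterate_add_apply]
    have h := le_amplify_iterate hq hq0 hq1 he0 (by linarith) (expansionRounds n)
    rw [hmin] at h
    exact (one_sub_amplify_iterate_le (by linarith)
      (amplify_iterate_mem _ ⟨by linarith, by linarith⟩).2 _).trans (pow_errorReductionRounds_le n)
  have hB : amplify^[errorReductionRounds n + expansionRounds n] (1 - q - e) ≤
      (1 / 2) ^ (n + 2) := by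
    rw [Function.iterate_add_apply]
    have h := amplify_iterate_le hq hq0 hq1 he0 he1 (expansionRounds n)
    rw [hmin] at h
    exact (amplify_iterate_le_pow (amplify_iterate_mem _ ⟨by linarith, by linarith⟩).1
      (by linarith) _).trans (pow_errorReductionRounds_le n)
  obtain ⟨P, hP, hR⟩ := key.exists_solvableOn_univ (by
    simp only [Finset.sum_const, Finset.card_univ, Fintype.card_finset, nsmul_eq_mul, ← hn, ← he]
    push_cast
    have h2 : (2 : ℝ) ^ n * (1 / 2) ^ (n + 2) = 1 / 4 := by
      rw [pow_add, ← mul_assoc, ← mul_pow]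
      norm_num
    have hA' := mul_le_mul_of_nonneg_left hA (by positivity : (0 : ℝ) ≤ 2 ^ n)
    have hB' := mul_le_mul_of_nonneg_left hB (by positivity : (0 : ℝ) ≤ 2 ^ n)
    linarith)
  exact ⟨P, fun x y => by simpa using hP x y, fun x y => hR x trivial y trivial⟩

/-! ### The relaxed clique game -/

namespace RelaxedCliqueGame

/-- The total cost of naming a vertex or a nonedge and of finding an element of a difference of
sets. -/
theorem cost_le {n : ℕ} (hn : 0 < n) {r : ℕ}
    (hr : r ≤ max (2 * Nat.clog 2 n)
      (2 * (errorReductionRounds n + expansionRounds n) + Nat.clog 2 n) + 1) :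
    (r : ℝ) ≤ 7.3 * Real.logb 2 n + 30 := by
  have clog_le {m : ℕ} : (Nat.clog 2 m : ℝ) ≤ Real.logb 2 m + 1 := by
    rcases Nat.eq_zero_or_pos m with rfl | hm
    · simp
    · rw [← Real.natCeil_logb_natCast]
      exact (Nat.ceil_lt_add_one (Real.logb_nonneg (by norm_num) (by exact_mod_cast hm))).le
  have hn1 : (1 : ℝ) ≤ n := by exact_mod_cast hn
  set L := Real.logb 2 n with hL
  have hL0 : 0 ≤ L := Real.logb_nonneg (by norm_num) hn1
  have h4 : Real.logb 2 (4 * n) = L + 2 := by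
    rw [Real.logb_mul (by norm_num) (by linarith), show (4 : ℝ) = 2 ^ 2 by norm_num,
      Real.logb_pow, Real.logb_self_eq_one (by norm_num)]
    push_cast
    ring
  have h1 : (Nat.clog 2 n : ℝ) ≤ L + 1 := clog_le
  have h2 : (errorReductionRounds n : ℝ) ≤ L + 7 := by
    have h : (Nat.clog 2 (n + 2) : ℝ) ≤ Real.logb 2 (n + 2 : ℕ) + 1 := clog_le
    have h' : Real.logb 2 (n + 2 : ℕ) ≤ Real.logb 2 (4 * n) :=
      Real.logb_le_logb_of_le (by norm_num) (by positivity) (by push_cast; linarith)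
    rw [errorReductionRounds]
    push_cast
    linarith
  have h3 : (expansionRounds n : ℝ) ≤ 15 / 7 * (L + 2) + 1 := by
    have h : (expansionRounds n : ℝ) < 15 / 7 * Real.logb 2 (2 * n + 1) + 1 :=
      Nat.ceil_lt_add_one
        (mul_nonneg (by norm_num) (Real.logb_nonneg (by norm_num) (by linarith)))
    have h' : Real.logb 2 (2 * n + 1) ≤ Real.logb 2 (4 * n) :=
      Real.logb_le_logb_of_le (by norm_num) (by positivity) (by linarith)
    linarith
  have hr' : (r : ℝ) ≤ max (2 * (Nat.clog 2 n : ℝ))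
      (2 * (errorReductionRounds n + expansionRounds n) + Nat.clog 2 n) + 1 := by exact_mod_cast hr
  refine hr'.trans ?_
  rw [← le_sub_iff_add_le]
  exact max_le (by linarith) (by linarith)

end RelaxedCliqueGame

theorem theorem3 :
    ∃ C : ℝ, ∀ (V : Type*) [Fintype V] [Nonempty V] (G : SimpleGraph V),
      ∃ P : CommProtocol (Finset V) (Finset V) (Sym2 V),
        RelaxedCliqueGame.Solves G P ∧
          RelaxedCliqueGame.CostAtMost G P (7.3 * Real.logb 2 (Fintype.card V) + C) := by
  refine ⟨30, fun V _ _ G => ?_⟩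
  classical
  set n := Fintype.card V with hn
  have hcard : n ≤ 2 ^ Nat.clog 2 n := Nat.le_pow_clog (by norm_num) _
  -- If `b` is not a clique, Bob sends a nonedge inside `b`.
  have hex (b : Finset V) : ∃ e : V × V, ¬ G.IsClique (b : Set V) →
      e.1 ∈ b ∧ e.2 ∈ b ∧ e.1 ≠ e.2 ∧ ¬ G.Adj e.1 e.2 := by
    by_cases h : G.IsClique (b : Set V)
    · exact ⟨Classical.arbitrary _, fun h' => absurd h h'⟩
    · simp only [SimpleGraph.IsClique, Set.Pairwise, not_forall] at h
      obtain ⟨u, hu, v, hv, huv, hadj⟩ := h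
      exact ⟨(u, v), fun _ => ⟨hu, hv, huv, hadj⟩⟩
  choose nonedge hnonedge using hex
  obtain ⟨P₀, hP₀⟩ := CommProtocol.exists_bob_sends (X := Finset V) (W := V × V)
    (k := 2 * Nat.clog 2 n)
    (by rw [Fintype.card_prod, two_mul, pow_add]; exact Nat.mul_le_mul hcard hcard)
    nonedge (fun e => s(e.1, e.2))
  -- Otherwise `b` extends to a maximal clique `m b`.
  have hex (b : Finset V) : ∃ m : Finset V, G.IsClique (b : Set V) →
      b ⊆ m ∧ Maximal (fun s : Finset V => G.IsClique (s : Set V)) m := by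
    by_cases h : G.IsClique (b : Set V)
    · obtain ⟨m, hm, hmax⟩ :=
        (Set.toFinite {s : Finset V | G.IsClique (s : Set V)}).exists_le_maximal h
      exact ⟨m, fun _ => ⟨hm, hmax⟩⟩
    · exact ⟨∅, fun h' => absurd h' h⟩
  choose m hm using hex
  obtain ⟨P₁, hbits, hP₁⟩ := exists_protocol_mem_sdiff (fun b => m b \ b)
  have hex (v : V) (b : Finset V) : ∃ u, G.IsClique (b : Set V) → v ∉ m b →
      u ∈ m b ∧ v ≠ u ∧ ¬ G.Adj v u := by
    by_cases h : G.IsClique (b : Set V) ∧ v ∉ m b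
    · by_contra! hno
      have hins : G.IsClique (insert v (m b) : Finset V) := by
        rw [Finset.coe_insert, SimpleGraph.isClique_insert]
        exact ⟨(hm b h.1).2.prop, fun u hu huv => (hno u).2.2 hu huv⟩
      exact h.2 ((hm b h.1).2.le_of_ge hins (Finset.subset_insert _ _)
        (Finset.mem_insert_self _ _))
    · exact ⟨v, fun h1 h2 => absurd ⟨h1, h2⟩ h⟩
  choose nonnbr hnonnbr using hex
  choose Q hQ using fun v : V => CommProtocol.exists_bob_sends (X := Finset V) (W := V)
    (k := Nat.clog 2 n) hcard (nonnbr v) (fun u => s(v, u))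
  refine ⟨.bob (fun b => decide (G.IsClique (b : Set V))) P₀ (P₁.bind Q),
    fun a b hab => ?_, fun a b _ => ?_⟩
  · by_cases hb : G.IsClique (b : Set V)
    · simp only [CommProtocol.output, hb, decide_true, if_true, CommProtocol.output_bind,
        (hQ _ a b).1]
      obtain ⟨hbm, hmax⟩ := hm b hb
      have hlt : (m b \ b).card < a.card := by
        have h1 : (m b).card ≤ G.cliqueNum := hmax.prop.card_le_cliqueNum
        have h2 := Finset.card_sdiff_add_card_eq_card hbm
        have := hab.2
        omega
      obtain ⟨hva, hvc⟩ := hP₁ a b hlt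
      set v := P₁.output a b with hv
      have hvb : v ∉ b := Finset.disjoint_left.1 hab.1 hva
      have hvm : v ∉ m b := fun h => hvc (Finset.mem_sdiff.2 ⟨h, hvb⟩)
      obtain ⟨hum, hne, hadj⟩ := hnonnbr v b hb hvm
      refine ⟨by simpa using ⟨hne, hadj⟩, ?_⟩
      by_cases hub : nonnbr v b ∈ b
      · left
        simp [hva, hub]
      · refine Or.inr ⟨v, hva, _, ⟨hub, fun u hu => ?_⟩, rfl⟩
        exact hmax.prop hum (hbm hu) fun h => hub (h ▸ hu)
    · obtain ⟨h1, h2, hne, hadj⟩ := hnonedge b hb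
      simp only [CommProtocol.output, hb, decide_false, Bool.false_eq_true, if_false, (hP₀ a b).1]
      refine ⟨by simpa using ⟨hne, hadj⟩, Or.inl ?_⟩
      simp [h1, h2]
  · refine RelaxedCliqueGame.cost_le Fintype.card_pos ?_
    rw [← hn]
    have h1 := (hP₀ a b).2
    have h2 := hbits a b
    rw [← hn] at h2
    have h3 := (hQ (P₁.output a b) a b).2
    simp only [CommProtocol.bits, CommProtocol.bits_bind]
    split <;> omega
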